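/- For $a\in\mathbb{C}$ and $n\ge 0$ let $(a)_n=a(a+1)\cdots(a+n-1)$ (with $(a)_0=1$), let $${}_3F_2\left({\alpha_1,\alpha_2,\alpha_3\atop \beta_1,\beta_2};z\right)=\sum_{n=0}^\infty\frac{(\alpha_1)_n(\alpha_2)_n(\alpha_3)_n}{n!\,(\beta_1)_n(\beta_2)_n}z^n,$$ let $\psi=\Gamma'/\Gamma$ be the digamma function and $\gamma$ Euler's constant. Then there is a real number $\delta>0$ such that for all $a,b,c\in\mathbb{C}$ with $|\Re a|<\delta$, $|\Re b|<\delta$, $|\Re c|<\delta$ and $a\neq 0$, $b\neq 0$, $a+b\neq 0$, both series below converge absolutely and $$\begin{aligned}{}_3F_2\left({a,b,c\atop a+b,\,1+c};1\right)={}&\frac{\Gamma(a+b)\Gamma(1+c)\Gamma(1+c-a-b)}{\Gamma(a)\Gamma(b)\Gamma(1+c-a)\Gamma(1+c-b)}\bigl(\psi(1+c-b)-\psi(a)-\psi(b)-\gamma\bigr)\\&-\frac{\Gamma(a+b)\Gamma(1+c)\Gamma(1+c-a-b)}{\Gamma(a)\Gamma(b)\Gamma(1+c-a)\Gamma(1+c-b)}\sum_{n=1}^\infty\frac{(a)_n(1-b)_n}{n\cdot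 n!\,(1+c-b)_n}.\end{aligned}$$ -/

import Mathlib

noncomputable section

/-- The Pochhammer symbol `(a)_n = a (a + 1) ⋯ (a + n - 1)`, with `(a)_0 = 1`. -/
def poch (a : ℂ) (n : ℕ) : ℂ := (ascPochhammer ℂ n).eval a

/-- The `n`-th term of the generalized hypergeometric series `₃F₂(α₁, α₂, α₃; β₁, β₂; z)`. -/
def hyp3F2Term (α₁ α₂ α₃ β₁ β₂ z : ℂ) (n : ℕ) : ℂ :=
  poch α₁ n * poch α₂ n * poch α₃ n / ((n.factorial : ℂ) * poch β₁ n * poch β₂ n) * z ^ n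

/-- The generalized hypergeometric function `₃F₂(α₁, α₂, α₃; β₁, β₂; z)`, as the sum of its
series. -/
def hyp3F2 (α₁ α₂ α₃ β₁ β₂ z : ℂ) : ℂ := ∑' n : ℕ, hyp3F2Term α₁ α₂ α₃ β₁ β₂ z n

/-- The `n`-th term `(a)_n (1 - b)_n / (n · n! · (1 + c - b)_n)`, meant for `n ≥ 1`. -/
def keyTerm (a b c : ℂ) (n : ℕ) : ℂ :=
  poch a n * poch (1 - b) n / ((n : ℂ) * (n.factorial : ℂ) * poch (1 + c - b) n)

/-- The factor
`Γ(a+b) Γ(1+c) Γ(1+c-a-b) / (Γ(a) Γ(b) Γ(1+c-a) Γ(1+c-b))`. -/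
def gammaFactor (a b c : ℂ) : ℂ :=
  Complex.Gamma (a + b) * Complex.Gamma (1 + c) * Complex.Gamma (1 + c - a - b) /
    (Complex.Gamma a * Complex.Gamma b * Complex.Gamma (1 + c - a) * Complex.Gamma (1 + c - b))

end

/-!
As functions of `c`, both sides of the formula satisfy the same first-order inhomogeneous
recurrence relating `c` and `c + 1`: for the series by telescoping, for the closed form by Gauss's
evaluation of the `₂F₁` series that appears when consecutive sums of key terms are subtracted.
Their difference therefore satisfies a homogeneous recurrence, whose solutions are determined by
their limit along `c, c + 1, c + 2, …` up to a quotient of Gamma functions, so it is enough to show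
that both sides equal `Γ(a + b) / (Γ(a) Γ(b)) · (log N - ψ(a) - ψ(b) - γ) + o(1)` at `c + N`.

For the closed form this is `ψ(z + N) - log N → 0`. For the series, termwise comparison shows that
the expansion does not depend on `c`. When `a` and `b` have positive real part it can be read off
at `c = a + b`, where the `₃F₂` reduces to a Gauss `₂F₁` and the formula holds by inspection; a
contiguity relation then moves `b`, and by symmetry `a`, to the left by integers.
-/

open Filter Topology Asymptotics Complex

theorem poch_zero (a : ℂ) : poch a 0 = 1 := by simp [poch]

theorem poch_succ (a : ℂ) (n : ℕ) : poch a (n + 1) = poch a n * (a + n) := by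
  simp [poch, ascPochhammer_succ_eval]

theorem poch_succ_left (a : ℂ) (n : ℕ) : poch a (n + 1) = a * poch (a + 1) n := by
  simp [poch, ascPochhammer_succ_left, Polynomial.eval_comp]

theorem poch_one (n : ℕ) : poch 1 n = n.factorial := ascPochhammer_eval_one ℂ n

theorem mul_poch_add_one (a : ℂ) (n : ℕ) : a * poch (a + 1) n = poch a n * (a + n) := by
  rw [← poch_succ_left, poch_succ]

theorem poch_eq_prod_range (a : ℂ) (n : ℕ) : poch a n = ∏ j ∈ Finset.range n, (a + j) := by
  induction n with
  | zero => simp [poch_zero]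
  | succ n ih => rw [poch_succ, ih, Finset.prod_range_succ]

theorem ne_neg_natCast_of_re_pos {a : ℂ} (ha : 0 < a.re) (m : ℕ) : a ≠ -m := by
  rintro rfl
  have : (0 : ℝ) ≤ m := m.cast_nonneg
  simp only [neg_re, natCast_re] at ha
  linarith

theorem add_natCast_ne_zero {a : ℂ} (ha : ∀ m : ℕ, a ≠ -m) (n : ℕ) : a + n ≠ 0 :=
  fun h => ha n (eq_neg_of_add_eq_zero_left h)

theorem add_natCast_ne_neg_natCast {a : ℂ} (ha : ∀ m : ℕ, a ≠ -m) (n m : ℕ) : a + n ≠ -m :=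
  fun h => ha (n + m) (by push_cast; linear_combination h)

theorem add_one_ne_neg_natCast {a : ℂ} (ha : ∀ m : ℕ, a ≠ -m) (m : ℕ) : a + 1 ≠ -m := by
  simpa using add_natCast_ne_neg_natCast ha 1 m

theorem one_add_ne_neg_natCast {a : ℂ} (ha : ∀ m : ℕ, a ≠ -m) (m : ℕ) : 1 + a ≠ -m := by
  rw [add_comm]
  exact add_one_ne_neg_natCast ha m

theorem poch_ne_zero {a : ℂ} (ha : ∀ m : ℕ, a ≠ -m) (n : ℕ) : poch a n ≠ 0 := by
  rw [poch_eq_prod_range]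
  exact Finset.prod_ne_zero_iff.2 fun j _ => add_natCast_ne_zero ha j

theorem norm_poch_le_norm_poch {a b : ℂ} (h : ∀ j : ℕ, ‖a + j‖ ≤ ‖b + j‖) (n : ℕ) :
    ‖poch a n‖ ≤ ‖poch b n‖ := by
  simp only [poch_eq_prod_range, norm_prod]
  exact Finset.prod_le_prod (fun _ _ => norm_nonneg _) fun j _ => h j

theorem continuous_poch (n : ℕ) : Continuous fun a => poch a n :=
  (ascPochhammer ℂ n).continuous

theorem tendsto_inv_GammaSeq (a : ℂ) :
    Tendsto (fun n => (GammaSeq a n)⁻¹) atTop (𝓝 (Gamma a)⁻¹) := by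
  by_cases h : Gamma a = 0
  · obtain ⟨m, rfl⟩ := Gamma_eq_zero_iff a |>.1 h
    rw [h, inv_zero]
    refine tendsto_const_nhds.congr' ?_
    filter_upwards [eventually_ge_atTop m] with n hn
    rw [GammaSeq, Finset.prod_eq_zero (Finset.mem_range.2 (Nat.lt_succ_of_le hn))
      (neg_add_cancel _), div_zero, inv_zero]
  · exact (GammaSeq_tendsto_Gamma a).inv₀ h

theorem tendsto_natCast_cpow_mul_poch_div_poch (a : ℂ) {c : ℂ} (hc : ∀ m : ℕ, c ≠ -m) :
    Tendsto (fun n : ℕ => (n : ℂ) ^ (c - a) * (poch a n / poch c n)) atTop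
      (𝓝 (Gamma c / Gamma a)) := by
  have h := ((GammaSeq_tendsto_Gamma c).mul (tendsto_inv_GammaSeq a)).mul
    (tendsto_add_mul_div_add_mul_atTop_nhds c a (1 : ℂ) one_ne_zero)
  rw [div_one, mul_one, ← div_eq_mul_inv] at h
  refine h.congr' ?_
  filter_upwards [eventually_ne_atTop 0,
    tendsto_natCast_atTop_cobounded.eventually_ne_cobounded (-a)] with n hn han
  have hn : (n : ℂ) ≠ 0 := Nat.cast_ne_zero.2 hn
  have hfact : (n.factorial : ℂ) ≠ 0 := Nat.cast_ne_zero.2 n.factorial_ne_zero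
  have hpow : (n : ℂ) ^ a ≠ 0 := fun h => hn (cpow_eq_zero_iff _ _ |>.1 h).1
  have hc_poch := poch_ne_zero hc n
  have hcn := add_natCast_ne_zero hc n
  have han : a + n ≠ 0 := fun h => han (eq_neg_of_add_eq_zero_right h)
  rw [GammaSeq, GammaSeq, ← poch_eq_prod_range, ← poch_eq_prod_range, poch_succ, poch_succ,
    cpow_sub _ _ hn]
  field_simp

theorem summable_of_tendsto_natCast_cpow_mul {f : ℕ → ℂ} {s l : ℂ} (hs : 1 < s.re)
    (h : Tendsto (fun n : ℕ => (n : ℂ) ^ s * f n) atTop (𝓝 l)) : Summable f := by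
  refine summable_of_isBigO_nat (Real.summable_nat_rpow.2 (neg_lt_neg hs)) ?_
  obtain ⟨C, hC⟩ := (h.isBigO_one ℝ).bound
  refine IsBigO.of_bound C ?_
  filter_upwards [hC, eventually_gt_atTop 0] with n hn hpos
  have hpow : 0 < (n : ℝ) ^ s.re := Real.rpow_pos_of_pos (Nat.cast_pos.2 hpos) _
  rw [norm_mul, norm_natCast_cpow_of_pos hpos, norm_one, mul_one] at hn
  rw [Real.rpow_neg n.cast_nonneg, norm_inv, Real.norm_of_nonneg hpow.le, ← div_eq_mul_inv,
    le_div_iff₀ hpow, mul_comm]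
  exact hn

theorem tendsto_natCast_cpow_zero {s : ℂ} (hs : s.re < 0) :
    Tendsto (fun n : ℕ => (n : ℂ) ^ s) atTop (𝓝 0) := by
  rw [tendsto_zero_iff_norm_tendsto_zero]
  refine ((tendsto_rpow_neg_atTop (neg_pos.2 hs)).comp tendsto_natCast_atTop_atTop).congr' ?_
  filter_upwards [eventually_gt_atTop 0] with n hn
  simp [norm_natCast_cpow_of_pos hn]

theorem tsum_eq_of_forall_eq_sub {f v : ℕ → ℂ} {l : ℂ} (hf : Summable f)
    (h : ∀ n, f n = v n - v (n + 1)) (hv : Tendsto v atTop (𝓝 l)) : ∑' n, f n = v 0 - l := by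
  refine tendsto_nhds_unique hf.hasSum.tendsto_sum_nat ((tendsto_const_nhds.sub hv).congr ?_)
  exact fun N => by rw [Finset.sum_congr rfl fun n _ => h n, Finset.sum_range_sub']

theorem eq_Gamma_mul_of_recurrence {f : ℕ → ℂ} {l a b c d : ℂ} (hsum : a + b = c + d)
    (hc : ∀ m : ℕ, c ≠ -m) (hd : ∀ m : ℕ, d ≠ -m)
    (hf : ∀ n : ℕ, (c + n) * (d + n) * f n = (a + n) * (b + n) * f (n + 1))
    (hl : Tendsto f atTop (𝓝 l)) :
    f 0 = Gamma c * Gamma d / (Gamma a * Gamma b) * l := by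
  have hpoch (n : ℕ) : f 0 = poch a n / poch c n * (poch b n / poch d n) * f n := by
    induction n with
    | zero => simp [poch_zero]
    | succ n ih =>
      have hc_poch := poch_ne_zero hc n
      have hd_poch := poch_ne_zero hd n
      have hcn := add_natCast_ne_zero hc n
      have hdn := add_natCast_ne_zero hd n
      rw [ih, poch_succ, poch_succ, poch_succ, poch_succ]
      field_simp
      linear_combination poch a n * poch b n * hf n
  have h := ((tendsto_natCast_cpow_mul_poch_div_poch a hc).mul
    (tendsto_natCast_cpow_mul_poch_div_poch b hd)).mul hl
  rw [div_mul_div_comm] at h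
  refine tendsto_nhds_unique (tendsto_const_nhds.congr' ?_) h
  filter_upwards [eventually_ne_atTop 0] with n hn
  have hpow : (n : ℂ) ^ (c - a) * (n : ℂ) ^ (d - b) = 1 := by
    rw [← cpow_add _ _ (Nat.cast_ne_zero.2 hn), show c - a + (d - b) = 0 by
      linear_combination -hsum, cpow_zero]
  rw [hpoch n]
  linear_combination (-(poch a n / poch c n * (poch b n / poch d n)) * f n) * hpow

/-- The `n`-th term of Gauss' series `₂F₁(a, b; c; 1)`, the value at `1` of Mathlib's series with
coefficients `ordinaryHypergeometricCoefficient`. -/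
noncomputable def gaussTerm (a b c : ℂ) (n : ℕ) : ℂ :=
  poch a n * poch b n / (n.factorial * poch c n)

theorem ordinaryHypergeometric_one_eq_tsum (a b c : ℂ) :
    ₂F₁ a b c (1 : ℂ) = ∑' n, gaussTerm a b c n := by
  rw [ordinaryHypergeometric_eq_tsum]
  refine tsum_congr fun n => ?_
  rw [one_pow, smul_eq_mul, mul_one, gaussTerm, div_eq_mul_inv, mul_inv]
  simp only [poch]
  ring

theorem gaussTerm_zero (a b c : ℂ) : gaussTerm a b c 0 = 1 := by
  simp [gaussTerm, poch_zero]

theorem ordinaryHypergeometric_one_zero_right (a c : ℂ) : ₂F₁ a 0 c (1 : ℂ) = 1 := by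
  rw [ordinaryHypergeometric_one_eq_tsum, tsum_eq_single 0, gaussTerm_zero]
  rintro (_ | n) hn
  · exact absurd rfl hn
  · simp [gaussTerm, poch_succ_left 0]

section

variable (a b : ℂ) {c : ℂ}

theorem gaussTerm_succ (hc : ∀ m : ℕ, c ≠ -m) (n : ℕ) :
    (n + 1) * (c + n) * gaussTerm a b c (n + 1) = (a + n) * (b + n) * gaussTerm a b c n := by
  have hpoch := poch_ne_zero hc n
  have hcn := add_natCast_ne_zero hc n
  have hfact : (n.factorial : ℂ) ≠ 0 := Nat.cast_ne_zero.2 n.factorial_ne_zero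
  have hn : (n : ℂ) + 1 ≠ 0 := n.cast_add_one_ne_zero
  rw [gaussTerm, gaussTerm, poch_succ, poch_succ, poch_succ, Nat.factorial_succ]
  push_cast
  field_simp

theorem gaussTerm_add_one_right (hc : ∀ m : ℕ, c ≠ -m) (n : ℕ) :
    (c + n) * gaussTerm a b (c + 1) n = c * gaussTerm a b c n := by
  have hpoch := poch_ne_zero hc n
  have hpoch' := poch_ne_zero (add_one_ne_neg_natCast hc) n
  have hfact : (n.factorial : ℂ) ≠ 0 := Nat.cast_ne_zero.2 n.factorial_ne_zero
  rw [gaussTerm, gaussTerm]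
  field_simp
  linear_combination -(poch a n * poch b n) * mul_poch_add_one c n

theorem tendsto_natCast_cpow_mul_gaussTerm (hc : ∀ m : ℕ, c ≠ -m) :
    Tendsto (fun n : ℕ => (n : ℂ) ^ (c + 1 - a - b) * gaussTerm a b c n) atTop
      (𝓝 (Gamma c / (Gamma a * Gamma b))) := by
  have h := (tendsto_natCast_cpow_mul_poch_div_poch a hc).mul
    (tendsto_natCast_cpow_mul_poch_div_poch b (c := 1) (ne_neg_natCast_of_re_pos (by simp)))
  rw [div_mul_div_comm, Gamma_one, mul_one] at h
  refine h.congr' ?_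
  filter_upwards [eventually_ne_atTop 0] with n hn
  rw [gaussTerm, poch_one, show c + 1 - a - b = c - a + (1 - b) by ring,
    cpow_add _ _ (Nat.cast_ne_zero.2 hn)]
  ring

theorem summable_gaussTerm (hc : ∀ m : ℕ, c ≠ -m) (h : 0 < (c - a - b).re) :
    Summable (gaussTerm a b c) :=
  summable_of_tendsto_natCast_cpow_mul (by simp at h ⊢; linarith)
    (tendsto_natCast_cpow_mul_gaussTerm a b hc)

theorem summable_gaussTerm_div (hc : ∀ m : ℕ, c ≠ -m) (h : 0 < (c + 1 - a - b).re) :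
    Summable fun n : ℕ => gaussTerm a b c (n + 1) / (n + 1 : ℂ) := by
  have hsum : Summable fun n : ℕ => gaussTerm a b c n / n := by
    refine summable_of_tendsto_natCast_cpow_mul (s := c + 1 - a - b + 1) (by simp at h ⊢; linarith)
      ((tendsto_natCast_cpow_mul_gaussTerm a b hc).congr' ?_)
    filter_upwards [eventually_ne_atTop 0] with n hn
    have hn : (n : ℂ) ≠ 0 := Nat.cast_ne_zero.2 hn
    rw [cpow_add _ _ hn, cpow_one]
    field_simp
  simpa using (summable_nat_add_iff 1).2 hsum

theorem tendsto_natCast_mul_gaussTerm (hc : ∀ m : ℕ, c ≠ -m) (h : 0 < (c - a - b).re) :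
    Tendsto (fun n : ℕ => n * gaussTerm a b c n) atTop (𝓝 0) := by
  have hlim := (tendsto_natCast_cpow_zero (s := -(c - a - b)) (by simpa using h)).mul
    (tendsto_natCast_cpow_mul_gaussTerm a b hc)
  rw [zero_mul] at hlim
  refine hlim.congr' ?_
  filter_upwards [eventually_ne_atTop 0] with n hn
  have hn : (n : ℂ) ≠ 0 := Nat.cast_ne_zero.2 hn
  rw [← mul_assoc, ← cpow_add _ _ hn, show -(c - a - b) + (c + 1 - a - b) = 1 by ring, cpow_one]

theorem ordinaryHypergeometric_one_add_one_right (hc : ∀ m : ℕ, c ≠ -m)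
    (h : 0 < (c - a - b).re) :
    c * (c - a - b) * ₂F₁ a b c (1 : ℂ) = (c - a) * (c - b) * ₂F₁ a b (c + 1) (1 : ℂ) := by
  have hsum := (summable_gaussTerm a b hc h).mul_left (c * (c - a - b))
  have hsum' := (summable_gaussTerm a b (add_one_ne_neg_natCast hc)
    (by simp at h ⊢; linarith)).mul_left ((c - a) * (c - b))
  rw [ordinaryHypergeometric_one_eq_tsum, ordinaryHypergeometric_one_eq_tsum, ← tsum_mul_left,
    ← tsum_mul_left, ← sub_eq_zero, ← hsum.tsum_sub hsum',
    tsum_eq_of_forall_eq_sub (v := fun n => c * (n * gaussTerm a b c n)) (hsum.sub hsum') ?_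
      ((tendsto_natCast_mul_gaussTerm a b hc h).const_mul c)]
  · simp
  · intro n
    apply mul_right_cancel₀ (add_natCast_ne_zero hc n)
    push_cast
    linear_combination -(c - a) * (c - b) * gaussTerm_add_one_right a b hc n +
      c * gaussTerm_succ a b hc n

end

theorem norm_le_norm_add_natCast {z : ℂ} (hz : 0 < z.re) (N : ℕ) : ‖z‖ ≤ ‖z + N‖ := by
  rw [← sq_le_sq₀ (norm_nonneg _) (norm_nonneg _), Complex.sq_norm, Complex.sq_norm, normSq_apply,
    normSq_apply]
  simp only [add_re, add_im, natCast_re, natCast_im, add_zero]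
  nlinarith [N.cast_nonneg (α := ℝ)]

theorem natCast_le_norm_add_natCast {z : ℂ} (hz : 0 < z.re) (N : ℕ) : (N : ℝ) ≤ ‖z + N‖ :=
  le_trans (by simpa using hz.le) (re_le_norm _)

theorem natCast_mul_norm_poch_le {c : ℂ} (hc : 0 < c.re) (N n : ℕ) :
    N * ‖poch c (n + 1)‖ ≤ ‖c‖ * ‖poch (c + N) (n + 1)‖ := by
  have hpoch : ‖poch (c + 1) n‖ ≤ ‖poch (c + N + 1) n‖ := by
    refine norm_poch_le_norm_poch (fun j => ?_) n
    rw [show c + N + 1 + j = c + 1 + j + N by ring]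
    exact norm_le_norm_add_natCast (by simp only [add_re, one_re, natCast_re]; positivity) N
  rw [poch_succ_left, poch_succ_left, norm_mul, norm_mul, mul_left_comm]
  gcongr
  exact natCast_le_norm_add_natCast hc N

theorem natCast_mul_norm_gaussTerm_le (a b : ℂ) {c : ℂ} (hc : 0 < c.re) (N n : ℕ) :
    N * ‖gaussTerm a b (c + N) (n + 1)‖ ≤ ‖c‖ * ‖gaussTerm a b c (n + 1)‖ := by
  have hpoch := norm_pos_iff.2 (poch_ne_zero (ne_neg_natCast_of_re_pos hc) (n + 1))
  have hpochN := norm_pos_iff.2 (poch_ne_zero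
    (add_natCast_ne_neg_natCast (ne_neg_natCast_of_re_pos hc) N) (n + 1))
  have hratio : N / ‖poch (c + N) (n + 1)‖ ≤ ‖c‖ / ‖poch c (n + 1)‖ := by
    rw [div_le_div_iff₀ hpochN hpoch]
    exact natCast_mul_norm_poch_le hc N n
  have h := mul_le_mul_of_nonneg_left hratio
    (norm_nonneg (poch a (n + 1) * poch b (n + 1) / (n + 1).factorial))
  rw [gaussTerm, gaussTerm, ← div_div, ← div_div, norm_div _ (poch _ _), norm_div _ (poch _ _)]
  linear_combination h

theorem isBigO_tsum_gaussTerm_mul (a b : ℂ) {c : ℂ} (hc : 0 < c.re) {w : ℕ → ℂ}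
    (h : Summable fun n => gaussTerm a b c (n + 1) * w n) :
    (fun N : ℕ => ∑' n, gaussTerm a b (c + N) (n + 1) * w n) =O[atTop] fun N => (N : ℝ)⁻¹ := by
  refine IsBigO.of_bound (‖c‖ * ∑' n, ‖gaussTerm a b c (n + 1) * w n‖) ?_
  filter_upwards [eventually_gt_atTop 0] with N hN
  have hN : (0 : ℝ) < N := Nat.cast_pos.2 hN
  rw [norm_inv, Real.norm_natCast]
  refine tsum_of_norm_bounded ((h.norm.hasSum.mul_left ‖c‖).mul_right (N : ℝ)⁻¹) fun n => ?_
  rw [le_mul_inv_iff₀ hN, norm_mul, norm_mul]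
  calc _ = N * ‖gaussTerm a b (c + N) (n + 1)‖ * ‖w n‖ := by ring
    _ ≤ ‖c‖ * ‖gaussTerm a b c (n + 1)‖ * ‖w n‖ := by
      gcongr ?_ * _
      exact natCast_mul_norm_gaussTerm_le a b hc N n
    _ = _ := by ring

theorem isBigO_ordinaryHypergeometric_sub_one (a b : ℂ) {c : ℂ} (hc : 0 < c.re)
    (h : 0 < (c - a - b).re) :
    (fun N : ℕ => ₂F₁ a b (c + N) (1 : ℂ) - 1) =O[atTop] fun N => (N : ℝ)⁻¹ := by
  have hc' := ne_neg_natCast_of_re_pos hc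
  have hsum := (summable_nat_add_iff 1).2 (summable_gaussTerm a b hc' h)
  refine (isBigO_tsum_gaussTerm_mul a b hc (w := fun _ => 1) (by simpa using hsum)).congr_left
    fun N => ?_
  have hsumN := summable_gaussTerm a b (add_natCast_ne_neg_natCast hc' N)
    (by simp at h ⊢; linarith [N.cast_nonneg (α := ℝ)])
  rw [ordinaryHypergeometric_one_eq_tsum, hsumN.tsum_eq_zero_add, gaussTerm_zero]
  simp

theorem tendsto_ordinaryHypergeometric_add_natCast (a b c : ℂ) :
    Tendsto (fun N : ℕ => ₂F₁ a b (c + N) (1 : ℂ)) atTop (𝓝 1) := by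
  obtain ⟨k, hk⟩ := exists_nat_gt (max (-c.re) (-(c - a - b).re))
  obtain ⟨hc, hcab⟩ := max_lt_iff.1 hk
  have h := (isBigO_ordinaryHypergeometric_sub_one a b (c := c + k) (by simp; linarith)
    (by simp at hcab ⊢; linarith)).trans_tendsto tendsto_inv_atTop_nhds_zero_nat
  rw [← tendsto_sub_nhds_zero_iff, ← tendsto_add_atTop_iff_nat k]
  refine h.congr fun N => ?_
  rw [add_assoc, add_comm (k : ℂ), ← Nat.cast_add]

theorem ordinaryHypergeometric_one_eq_Gamma (a b : ℂ) {c : ℂ} (hc : ∀ m : ℕ, c ≠ -m)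
    (h : 0 < (c - a - b).re) :
    ₂F₁ a b c (1 : ℂ) = Gamma c * Gamma (c - a - b) / (Gamma (c - a) * Gamma (c - b)) := by
  have hrec (n : ℕ) : (c + n) * (c - a - b + n) * ₂F₁ a b (c + n) (1 : ℂ) =
      (c - a + n) * (c - b + n) * ₂F₁ a b (c + (n + 1 : ℕ)) (1 : ℂ) := by
    have hn := ordinaryHypergeometric_one_add_one_right a b (add_natCast_ne_neg_natCast hc n)
      (by simp at h ⊢; linarith [n.cast_nonneg (α := ℝ)])
    push_cast
    rw [← add_assoc]
    linear_combination hn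
  simpa using eq_Gamma_mul_of_recurrence (f := fun n : ℕ => ₂F₁ a b (c + n) (1 : ℂ)) (by ring) hc
    (ne_neg_natCast_of_re_pos h) hrec (tendsto_ordinaryHypergeometric_add_natCast a b c)

theorem gaussTerm_succ_eq_mul (a b c : ℂ) (n : ℕ) :
    gaussTerm a b c (n + 1) =
      b * (poch a (n + 1) * poch (b + 1) n / ((n + 1).factorial * poch c (n + 1))) := by
  rw [gaussTerm, poch_succ_left b]
  ring

theorem tendsto_inv_mul_gaussTerm (a c : ℂ) (n : ℕ) :
    Tendsto (fun b => b⁻¹ * gaussTerm a b c (n + 1)) (𝓝[≠] 0)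
      (𝓝 (gaussTerm a 1 c (n + 1) / (n + 1 : ℂ))) := by
  have hcont : Continuous fun b =>
      poch a (n + 1) * poch (b + 1) n / ((n + 1).factorial * poch c (n + 1)) :=
    ((((continuous_poch n).comp (continuous_add_const 1)).const_mul _).div_const _)
  have hlim := hcont.tendsto 0
  have hfact : (n.factorial : ℂ) ≠ 0 := Nat.cast_ne_zero.2 n.factorial_ne_zero
  have hn : (n : ℂ) + 1 ≠ 0 := n.cast_add_one_ne_zero
  have hval : gaussTerm a 1 c (n + 1) / (n + 1 : ℂ) =
      poch a (n + 1) * poch (0 + 1) n / ((n + 1).factorial * poch c (n + 1)) := by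
    rw [gaussTerm, zero_add, poch_one, poch_one, Nat.factorial_succ]
    push_cast
    field_simp
  rw [hval]
  refine (hlim.mono_left nhdsWithin_le_nhds).congr' ?_
  filter_upwards [self_mem_nhdsWithin] with b hb
  rw [gaussTerm_succ_eq_mul, inv_mul_cancel_left₀ hb]

theorem norm_inv_mul_gaussTerm_le (a c : ℂ) {b : ℂ} {ε : ℝ} (hb : b ≠ 0) (hbε : ‖b‖ ≤ ε) (n : ℕ) :
    ‖b⁻¹ * gaussTerm a b c (n + 1)‖ ≤ ‖(ε : ℂ)⁻¹ * gaussTerm a ε c (n + 1)‖ := by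
  have hε : 0 < ε := (norm_pos_iff.2 hb).trans_le hbε
  have hpoch : ‖poch (b + 1) n‖ ≤ ‖poch (ε + 1) n‖ := by
    refine norm_poch_le_norm_poch (fun j => ?_) n
    calc ‖b + 1 + j‖ ≤ ‖b‖ + ‖(1 : ℂ)‖ + ‖(j : ℂ)‖ := norm_add₃_le
      _ ≤ ((ε : ℂ) + 1 + j).re := by simpa using hbε
      _ ≤ ‖(ε : ℂ) + 1 + j‖ := re_le_norm _
  rw [gaussTerm_succ_eq_mul, gaussTerm_succ_eq_mul, inv_mul_cancel_left₀ hb,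
    inv_mul_cancel_left₀ (ofReal_ne_zero.2 hε.ne'), norm_div, norm_div, norm_mul,
    norm_mul (poch a _)]
  gcongr

section

variable (a : ℂ) {c : ℂ}

theorem hasDerivAt_ordinaryHypergeometric_one_zero (hc : ∀ m : ℕ, c ≠ -m) (h : 0 < (c - a).re) :
    HasDerivAt (fun b => ₂F₁ a b c (1 : ℂ))
      (∑' n : ℕ, gaussTerm a 1 c (n + 1) / (n + 1 : ℂ)) 0 := by
  set ε : ℝ := (c - a).re / 2 with hε
  have hε0 : 0 < ε := half_pos h
  have hsum (b : ℂ) (hb : ‖b‖ ≤ ε) : Summable (gaussTerm a b c) :=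
    summable_gaussTerm a b hc (by rw [sub_re]; linarith [re_le_norm b])
  have hbound := ((summable_nat_add_iff 1).2
    (hsum ε (by rw [norm_real, Real.norm_of_nonneg hε0.le]))).mul_left (ε : ℂ)⁻¹
  have hball : ∀ᶠ b : ℂ in 𝓝[≠] 0, b ≠ 0 ∧ ‖b‖ ≤ ε := by
    filter_upwards [self_mem_nhdsWithin, nhdsWithin_le_nhds (Metric.closedBall_mem_nhds 0 hε0)]
      with b hb hbε using ⟨hb, by simpa using hbε⟩
  rw [hasDerivAt_iff_tendsto_slope_zero]
  refine (tendsto_tsum_of_dominated_convergence hbound.norm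
    (fun n => tendsto_inv_mul_gaussTerm a c n)
    (hball.mono fun b hb n => norm_inv_mul_gaussTerm_le a c hb.1 hb.2 n)).congr' ?_
  filter_upwards [hball] with b hb
  rw [zero_add, ordinaryHypergeometric_one_zero_right, ordinaryHypergeometric_one_eq_tsum,
    (hsum b hb.2).tsum_eq_zero_add, gaussTerm_zero, add_sub_cancel_left, smul_eq_mul, tsum_mul_left]

theorem hasDerivAt_Gamma (hc : ∀ m : ℕ, c ≠ -m) :
    HasDerivAt Gamma (Gamma c * digamma c) c := by
  rw [digamma_def, logDeriv_apply, mul_div_cancel₀ _ (Gamma_ne_zero hc)]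
  exact (differentiableAt_Gamma c hc).hasDerivAt

theorem tsum_gaussTerm_one_div (hc : ∀ m : ℕ, c ≠ -m) (h : 0 < (c - a).re) :
    ∑' n : ℕ, gaussTerm a 1 c (n + 1) / (n + 1 : ℂ) = digamma c - digamma (c - a) := by
  have hca := ne_neg_natCast_of_re_pos h
  have hΓc := Gamma_ne_zero hc
  have hΓca := Gamma_ne_zero hca
  have hnum : HasDerivAt (fun b => Gamma (c - a - b)) (-(Gamma (c - a) * digamma (c - a))) 0 :=
    HasDerivAt.comp_const_sub (c - a) 0 (by simpa using hasDerivAt_Gamma hca)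
  have hden : HasDerivAt (fun b => Gamma (c - b)) (-(Gamma c * digamma c)) 0 :=
    HasDerivAt.comp_const_sub c 0 (by simpa using hasDerivAt_Gamma hc)
  have hquot := (hnum.const_mul (Gamma c)).div (hden.const_mul (Gamma (c - a)))
    (by simpa using ⟨hΓca, hΓc⟩)
  have hre : ∀ᶠ b : ℂ in 𝓝 0, 0 < (c - a - b).re :=
    ((by fun_prop : Continuous fun b : ℂ => (c - a - b).re).tendsto 0).eventually_const_lt
      (by simpa using h)
  have hGauss := hquot.congr_of_eventuallyEq
    (hre.mono fun b hb => ordinaryHypergeometric_one_eq_Gamma a b hc hb)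
  rw [(hasDerivAt_ordinaryHypergeometric_one_zero a hc h).unique hGauss]
  simp only [sub_zero]
  field_simp
  ring

end

theorem digamma_natCast_add_one (N : ℕ) :
    digamma (N + 1) = harmonic N - Real.eulerMascheroniConstant := by
  have hfact : (N.factorial : ℂ) ≠ 0 := Nat.cast_ne_zero.2 N.factorial_ne_zero
  rw [digamma_def, logDeriv_apply, deriv_Gamma_nat, Gamma_nat_eq_factorial,
    mul_div_cancel_left₀ _ hfact]
  ring

theorem tendsto_digamma_add_natCast_sub_log {z : ℂ} (hz : 0 < z.re) :
    Tendsto (fun N : ℕ => digamma (z + N) - Real.log N) atTop (𝓝 0) := by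
  have hone : ∀ m : ℕ, (1 : ℂ) ≠ -m := ne_neg_natCast_of_re_pos (by simp)
  have hsum := summable_gaussTerm_div (1 - z) 1 hone (by simpa using hz)
  have hdiff := (isBigO_tsum_gaussTerm_mul (1 - z) 1 (c := 1) (by simp)
    (w := fun n => (n + 1 : ℂ)⁻¹) hsum).trans_tendsto tendsto_inv_atTop_nhds_zero_nat
  have hharmonic : Tendsto (fun N : ℕ => ((harmonic N - Real.log N : ℝ) : ℂ)) atTop
      (𝓝 Real.eulerMascheroniConstant) :=
    (continuous_ofReal.tendsto _).comp Real.tendsto_harmonic_sub_log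
  have h := (hharmonic.sub_const (Real.eulerMascheroniConstant : ℂ)).sub hdiff
  rw [sub_self, sub_zero] at h
  refine h.congr fun N => ?_
  have hN := tsum_gaussTerm_one_div (1 - z) (add_natCast_ne_neg_natCast hone N)
    (by simp only [add_sub_sub_cancel, add_re, natCast_re]; positivity)
  rw [show 1 + (N : ℂ) - (1 - z) = z + N by ring, add_comm 1 (N : ℂ), digamma_natCast_add_one]
    at hN
  simp only [← div_eq_mul_inv, add_comm 1 (N : ℂ)]
  rw [hN]
  push_cast
  ring

theorem tsum_gaussTerm_div_sub (a b : ℂ) {c : ℂ} (hc : ∀ m : ℕ, c ≠ -m)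
    (h : 0 < (c + 1 - a - b).re) :
    (∑' n : ℕ, gaussTerm a b c (n + 1) / (n + 1 : ℂ)) -
        ∑' n : ℕ, gaussTerm a b (c + 1) (n + 1) / (n + 1 : ℂ) =
      (₂F₁ a b (c + 1) (1 : ℂ) - 1) / c := by
  have hc1 := add_one_ne_neg_natCast hc
  have hc0 : c ≠ 0 := by simpa using hc 0
  have hsum := summable_gaussTerm a b hc1 h
  rw [← (summable_gaussTerm_div a b hc h).tsum_sub
      (summable_gaussTerm_div a b hc1 (by simp at h ⊢; linarith)),
    ordinaryHypergeometric_one_eq_tsum, hsum.tsum_eq_zero_add, gaussTerm_zero,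
    add_sub_cancel_left, ← tsum_div_const]
  refine tsum_congr fun n => ?_
  have hn : (n : ℂ) + 1 ≠ 0 := n.cast_add_one_ne_zero
  have hterm := gaussTerm_add_one_right a b hc (n + 1)
  push_cast at hterm
  field_simp
  linear_combination -hterm

/-- The reciprocal `Γ(a + b) / (Γ(a) Γ(b))` of the beta function, the limit of `n` times
the `n`-th coefficient of `₂F₁(a, b; a + b; ·)`. -/
noncomputable def invBeta (a b : ℂ) : ℂ := Gamma (a + b) / (Gamma a * Gamma b)

theorem invBeta_comm (a b : ℂ) : invBeta a b = invBeta b a := by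
  rw [invBeta, invBeta, add_comm, mul_comm]

theorem invBeta_add_one_right (a : ℂ) {b : ℂ} (hb : b ≠ 0) (hab : a + b ≠ 0) :
    invBeta a (b + 1) = (a + b) / b * invBeta a b := by
  rw [invBeta, invBeta, ← add_assoc, Gamma_add_one _ hab, Gamma_add_one _ hb]
  ring

/-- The second factor `ψ(1 + c - b) - ψ(a) - ψ(b) - γ - ∑ (a)ₙ (1 - b)ₙ / (n · n! (1 + c - b)ₙ)` of
the closed form, so that the closed form is `gammaFactor a b c * digammaBracket a b c`. -/
noncomputable def digammaBracket (a b c : ℂ) : ℂ :=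
  digamma (1 + c - b) - digamma a - digamma b - Real.eulerMascheroniConstant -
    ∑' n : ℕ, keyTerm a b c (n + 1)

theorem keyTerm_succ (a b c : ℂ) (n : ℕ) :
    keyTerm a b c (n + 1) = gaussTerm a (1 - b) (1 + c - b) (n + 1) / (n + 1 : ℂ) := by
  rw [keyTerm, gaussTerm, div_div]
  push_cast
  ring

section

variable {a b c : ℂ}

theorem summable_keyTerm (hcb : ∀ m : ℕ, 1 + c - b ≠ -m) (hca : 0 < (1 + c - a).re) :
    Summable fun n => keyTerm a b c (n + 1) := by
  simp only [keyTerm_succ]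
  exact summable_gaussTerm_div a (1 - b) hcb (by simp at hca ⊢; linarith)

theorem digammaBracket_add_one_sub (hcb : ∀ m : ℕ, 1 + c - b ≠ -m) (hca : 0 < (1 + c - a).re) :
    digammaBracket a b (c + 1) - digammaBracket a b c =
      Gamma (1 + c - b) * Gamma (1 + c - a) / (Gamma (2 + c - a - b) * Gamma (1 + c)) := by
  have hcb0 : 1 + c - b ≠ 0 := by simpa using hcb 0
  have hseries := tsum_gaussTerm_div_sub a (1 - b) hcb (by simp at hca ⊢; linarith)
  have hGauss := ordinaryHypergeometric_one_eq_Gamma a (1 - b) (add_one_ne_neg_natCast hcb)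
    (by simp at hca ⊢; linarith)
  have hdigamma := digamma_apply_add_one _ hcb
  rw [Gamma_add_one _ hcb0, show 1 + c - b + 1 - a - (1 - b) = 1 + c - a by ring,
    show 1 + c - b + 1 - a = 2 + c - a - b by ring,
    show 1 + c - b + 1 - (1 - b) = 1 + c by ring] at hGauss
  simp only [digammaBracket, keyTerm_succ, show 1 + (c + 1) - b = 1 + c - b + 1 by ring]
  rw [hGauss] at hseries
  rw [hdigamma]
  linear_combination hseries + Gamma (1 + c - b) * Gamma (1 + c - a) /
    (Gamma (2 + c - a - b) * Gamma (1 + c)) * mul_inv_cancel₀ hcb0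

theorem gammaFactor_add_one (hc : 1 + c ≠ 0) (hca : 1 + c - a ≠ 0) (hcb : 1 + c - b ≠ 0)
    (hcab : 1 + c - a - b ≠ 0) :
    (1 + c - a) * (1 + c - b) * gammaFactor a b (c + 1) =
      (1 + c) * (1 + c - a - b) * gammaFactor a b c := by
  rw [gammaFactor, gammaFactor, show 1 + (c + 1) = 1 + c + 1 by ring,
    show 1 + c + 1 - a - b = 1 + c - a - b + 1 by ring,
    show 1 + c + 1 - a = 1 + c - a + 1 by ring, show 1 + c + 1 - b = 1 + c - b + 1 by ring,
    Gamma_add_one _ hc, Gamma_add_one _ hca, Gamma_add_one _ hcb, Gamma_add_one _ hcab,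
    mul_mul_mul_comm (Gamma a * Gamma b), mul_mul_mul_comm]
  field_simp

theorem gammaFactor_eq_invBeta_mul (hc : ∀ m : ℕ, 1 + c ≠ -m) (hcab : 0 < (1 + c - a - b).re) :
    gammaFactor a b c = invBeta a b * ₂F₁ a b (1 + c) (1 : ℂ) := by
  rw [ordinaryHypergeometric_one_eq_Gamma a b hc hcab, gammaFactor, invBeta]
  ring

theorem closedForm_add_one (hc : ∀ m : ℕ, 1 + c ≠ -m) (hcb : ∀ m : ℕ, 1 + c - b ≠ -m)
    (hcab : ∀ m : ℕ, 1 + c - a - b ≠ -m) (hca : 0 < (1 + c - a).re) :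
    (1 + c) * (1 + c - a - b) * (gammaFactor a b c * digammaBracket a b c) =
      (1 + c - a) * (1 + c - b) * (gammaFactor a b (c + 1) * digammaBracket a b (c + 1)) -
        (1 + c) * invBeta a b := by
  have hca' := ne_neg_natCast_of_re_pos hca
  have hc0 : 1 + c ≠ 0 := by simpa using hc 0
  have hca0 : 1 + c - a ≠ 0 := by simpa using hca' 0
  have hcb0 : 1 + c - b ≠ 0 := by simpa using hcb 0
  have hcab0 : 1 + c - a - b ≠ 0 := by simpa using hcab 0
  have hfactor := gammaFactor_add_one hc0 hca0 hcb0 hcab0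
  have hbracket := digammaBracket_add_one_sub hcb hca
  have hinhom : (1 + c - a - b) * gammaFactor a b c * (Gamma (1 + c - b) * Gamma (1 + c - a) /
      (Gamma (2 + c - a - b) * Gamma (1 + c))) = invBeta a b := by
    have hΓc := Gamma_ne_zero hc
    have hΓca := Gamma_ne_zero hca'
    have hΓcb := Gamma_ne_zero hcb
    have hΓcab := Gamma_ne_zero hcab
    rw [gammaFactor, invBeta, show 2 + c - a - b = 1 + c - a - b + 1 by ring,
      Gamma_add_one _ hcab0]
    field_simp
  linear_combination -digammaBracket a b (c + 1) * hfactor -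
    (1 + c) * (1 + c - a - b) * gammaFactor a b c * hbracket - (1 + c) * hinhom

end

/-- The asymptotic expansion `Γ(a + b) / (Γ(a) Γ(b)) · (log N - ψ(a) - ψ(b) - γ)`, up to `o(1)`,
of both sides of the formula when `c` is replaced by `c + N`. -/
noncomputable def logAsymptote (a b : ℂ) (N : ℕ) : ℂ :=
  invBeta a b * (Real.log N - digamma a - digamma b - Real.eulerMascheroniConstant)

theorem logAsymptote_comm (a b : ℂ) (N : ℕ) : logAsymptote a b N = logAsymptote b a N := by
  rw [logAsymptote, logAsymptote, invBeta_comm]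
  ring

theorem logAsymptote_add_one_right (a : ℂ) {b : ℂ} (hb : ∀ m : ℕ, b ≠ -m) (hab : a + b ≠ 0)
    (N : ℕ) : b / (a + b) * logAsymptote a (b + 1) N + invBeta a b / b = logAsymptote a b N := by
  have hb0 : b ≠ 0 := by simpa using hb 0
  rw [logAsymptote, logAsymptote, invBeta_add_one_right a hb0 hab, digamma_apply_add_one b hb]
  field_simp
  ring

theorem isLittleO_logAsymptote (a b : ℂ) : logAsymptote a b =o[atTop] fun N : ℕ => (N : ℝ) := by
  have hlog : (fun N : ℕ => (Real.log N : ℂ)) =o[atTop] fun N : ℕ => (N : ℝ) :=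
    isLittleO_ofReal_left.2 (Real.isLittleO_log_id_atTop.comp_tendsto tendsto_natCast_atTop_atTop)
  have hconst (z : ℂ) : (fun _ : ℕ => z) =o[atTop] fun N : ℕ => (N : ℝ) :=
    isLittleO_const_left.2 (.inr (tendsto_norm_atTop_atTop.comp tendsto_natCast_atTop_atTop))
  exact (((hlog.sub (hconst _)).sub (hconst _)).sub (hconst _)).const_mul_left _

theorem tendsto_mul_sub_logAsymptote (a b : ℂ) {q f : ℕ → ℂ}
    (hq : (fun N => q N - 1) =O[atTop] fun N : ℕ => (N : ℝ)⁻¹)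
    (hf : Tendsto (fun N => f N - logAsymptote a b N) atTop (𝓝 0)) :
    Tendsto (fun N => q N * f N - logAsymptote a b N) atTop (𝓝 0) := by
  have hq0 := hq.trans_tendsto tendsto_inv_atTop_nhds_zero_nat
  have hqL : Tendsto (fun N => (q N - 1) * logAsymptote a b N) atTop (𝓝 0) := by
    refine (isLittleO_one_iff ℝ).1
      ((hq.mul_isLittleO (isLittleO_logAsymptote a b)).congr' .rfl ?_)
    filter_upwards [eventually_ne_atTop 0] with N hN
    exact inv_mul_cancel₀ (Nat.cast_ne_zero.2 hN)
  have h := ((hq0.mul hf).add hqL).add hf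
  simp only [mul_zero, add_zero] at h
  exact h.congr fun N => by ring

theorem tendsto_closedForm_sub_logAsymptote {a b c : ℂ} (hc : 0 < (1 + c).re)
    (hca : 0 < (1 + c - a).re) (hcb : 0 < (1 + c - b).re) (hcab : 0 < (1 + c - a - b).re) :
    Tendsto (fun N : ℕ => gammaFactor a b (c + N) * digammaBracket a b (c + N) -
      logAsymptote a b N) atTop (𝓝 0) := by
  have hcb' := ne_neg_natCast_of_re_pos hcb
  have hseries := (isBigO_tsum_gaussTerm_mul a (1 - b) hcb (w := fun n => (n + 1 : ℂ)⁻¹)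
    (summable_gaussTerm_div a (1 - b) hcb' (by simp at hca ⊢; linarith))).trans_tendsto
      tendsto_inv_atTop_nhds_zero_nat
  have hbracket := ((tendsto_digamma_add_natCast_sub_log hcb).sub hseries).const_mul (invBeta a b)
  rw [sub_zero, mul_zero] at hbracket
  refine (tendsto_mul_sub_logAsymptote a b (isBigO_ordinaryHypergeometric_sub_one a b hc hcab)
    (f := fun N => invBeta a b * digammaBracket a b (c + N)) (hbracket.congr fun N => ?_)).congr
      fun N => ?_
  · simp only [digammaBracket, keyTerm_succ, logAsymptote, ← add_assoc, div_eq_mul_inv,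
      add_sub_right_comm]
    ring
  · rw [gammaFactor_eq_invBeta_mul
      (by simpa [add_assoc] using add_natCast_ne_neg_natCast (ne_neg_natCast_of_re_pos hc) N)
      (by simp at hcab ⊢; linarith [N.cast_nonneg (α := ℝ)]), ← add_assoc]
    ring

/-- The value `₃F₂(a, b, c; a + b, 1 + c; 1)`. -/
noncomputable def balanced3F2 (a b c : ℂ) : ℂ := hyp3F2 a b c (a + b) (1 + c) 1

theorem balanced3F2_comm (a b c : ℂ) : balanced3F2 a b c = balanced3F2 b a c := by
  simp only [balanced3F2, hyp3F2, hyp3F2Term, add_comm a b, mul_comm (poch a _)]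

theorem tendsto_natCast_cpow_mul_hyp3F2Term (a b c : ℂ) {d e : ℂ} (hd : ∀ m : ℕ, d ≠ -m)
    (he : ∀ m : ℕ, e ≠ -m) :
    Tendsto (fun n : ℕ => (n : ℂ) ^ (d + e + 1 - a - b - c) * hyp3F2Term a b c d e 1 n) atTop
      (𝓝 (Gamma d / (Gamma a * Gamma b) * (Gamma e / Gamma c))) := by
  refine ((tendsto_natCast_cpow_mul_gaussTerm a b hd).mul
    (tendsto_natCast_cpow_mul_poch_div_poch c he)).congr' ?_
  filter_upwards [eventually_ne_atTop 0] with n hn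
  rw [hyp3F2Term, gaussTerm, one_pow, mul_one,
    show d + e + 1 - a - b - c = d + 1 - a - b + (e - c) by ring,
    cpow_add _ _ (Nat.cast_ne_zero.2 hn)]
  ring

theorem summable_hyp3F2Term (a b c : ℂ) {d e : ℂ} (hd : ∀ m : ℕ, d ≠ -m) (he : ∀ m : ℕ, e ≠ -m)
    (h : 0 < (d + e - a - b - c).re) : Summable (hyp3F2Term a b c d e 1) :=
  summable_of_tendsto_natCast_cpow_mul (by simp at h ⊢; linarith)
    (tendsto_natCast_cpow_mul_hyp3F2Term a b c hd he)

theorem natCast_div_add_mul_cancel {c : ℂ} (hc : ∀ m : ℕ, 1 + c ≠ -m) (n : ℕ) :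
    n / (c + n) * (c + n) = n := by
  refine div_mul_cancel_of_imp fun hcn => ?_
  rcases n with _ | n
  · simp
  · exact absurd (by push_cast at hcn; linear_combination hcn) (hc n)

-- At `c = 0`, `n = 0` this relies on `0 / 0 = 0`.
theorem hyp3F2Term_add_one_eq_gaussTerm_mul (a b d : ℂ) {c : ℂ} (hc : ∀ m : ℕ, 1 + c ≠ -m)
    (n : ℕ) : hyp3F2Term a b c d (1 + c) 1 n = gaussTerm a b d n * (1 - n / (c + n)) := by
  have hratio : poch c n / poch (1 + c) n = 1 - n / (c + n) := by
    rcases n with _ | n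
    · simp [poch_zero]
    · have hcn : c + (n + 1 : ℕ) ≠ 0 := by
        have := add_natCast_ne_zero hc n
        push_cast
        convert this using 1
        ring
      rw [one_sub_div hcn, add_sub_cancel_right, div_eq_div_iff (poch_ne_zero hc _) hcn,
        add_comm 1 c, mul_poch_add_one]
  rw [hyp3F2Term, gaussTerm, one_pow, mul_one, ← hratio]
  ring

theorem gaussTerm_add_one_add_one (a b : ℂ) {c : ℂ} (hc : ∀ m : ℕ, c ≠ -m) (n : ℕ) :
    b * (c + n) * gaussTerm a (b + 1) (c + 1) n = c * (b + n) * gaussTerm a b c n := by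
  have hpoch := poch_ne_zero hc n
  have hpoch' := poch_ne_zero (add_one_ne_neg_natCast hc) n
  have hfact : (n.factorial : ℂ) ≠ 0 := Nat.cast_ne_zero.2 n.factorial_ne_zero
  rw [gaussTerm, gaussTerm]
  field_simp
  linear_combination (c + n) * poch a n * poch c n * mul_poch_add_one b n -
    (b + n) * poch a n * poch b n * mul_poch_add_one c n

section

variable {a b : ℂ} (hab : ∀ m : ℕ, a + b ≠ -m)
include hab

theorem tendsto_natCast_mul_gaussTerm_add :
    Tendsto (fun n : ℕ => n * gaussTerm a b (a + b) n) atTop (𝓝 (invBeta a b)) := by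
  have h := tendsto_natCast_cpow_mul_gaussTerm a b hab
  simpa only [invBeta, show a + b + 1 - a - b = 1 by ring, cpow_one] using h

theorem tendsto_gaussTerm_mul_div (c d : ℂ) :
    Tendsto (fun n : ℕ => gaussTerm a b (a + b) n * (n / (c + n)) * (n + d)) atTop
      (𝓝 (invBeta a b)) := by
  have h := (tendsto_natCast_mul_gaussTerm_add hab).mul
    (tendsto_add_mul_div_add_mul_atTop_nhds d c (1 : ℂ) one_ne_zero)
  rw [div_one, mul_one] at h
  exact h.congr fun n => by ring

theorem summable_balanced {c : ℂ} (hc : ∀ m : ℕ, 1 + c ≠ -m) :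
    Summable (hyp3F2Term a b c (a + b) (1 + c) 1) :=
  summable_hyp3F2Term a b c hab hc (by rw [show a + b + (1 + c) - a - b - c = 1 by ring]; simp)

theorem balanced3F2_add_one_right {c : ℂ} (hc : ∀ m : ℕ, 1 + c ≠ -m) :
    (1 + c) * (1 + c - a - b) * balanced3F2 a b c =
      (1 + c - a) * (1 + c - b) * balanced3F2 a b (c + 1) - (1 + c) * invBeta a b := by
  have hc1 : ∀ m : ℕ, 1 + (c + 1) ≠ -m := by
    simpa only [add_assoc] using add_one_ne_neg_natCast hc
  have hsum := (summable_balanced hab hc).mul_left ((1 + c) * (1 + c - a - b))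
  have hsum' := (summable_balanced hab hc1).mul_left ((1 + c - a) * (1 + c - b))
  have htel := tsum_eq_of_forall_eq_sub (hsum.sub hsum')
    (v := fun n : ℕ => (1 + c) * (gaussTerm a b (a + b) n * (n / (c + n)) * (n + (a + b - 1))))
    ?_ ((tendsto_gaussTerm_mul_div hab c (a + b - 1)).const_mul (1 + c))
  · rw [hsum.tsum_sub hsum', tsum_mul_left, tsum_mul_left] at htel
    simp only [Nat.cast_zero, zero_div, mul_zero, zero_mul, zero_sub] at htel
    rw [balanced3F2, balanced3F2, hyp3F2, hyp3F2]
    linear_combination htel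
  · intro n
    have hu := natCast_div_add_mul_cancel hc n
    have hcn := add_natCast_ne_zero hc n
    have ht := gaussTerm_succ a b hab n
    rw [hyp3F2Term_add_one_eq_gaussTerm_mul a b _ hc, hyp3F2Term_add_one_eq_gaussTerm_mul a b _ hc1]
    generalize (n : ℂ) / (c + n) = u at hu ⊢
    push_cast
    rw [show c + 1 + n = 1 + c + n by ring, show c + (n + 1 : ℂ) = 1 + c + n by ring]
    field_simp
    linear_combination -gaussTerm a b (a + b) n * (1 + c + n) * (1 + c) * hu + (1 + c) * ht

theorem hyp3F2Term_add_one_add_one_sub {c : ℂ} (hb : b ≠ 0) (hc : ∀ m : ℕ, 1 + c ≠ -m) (n : ℕ) :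
    (1 + c - a) / (1 + c) * (b / (a + b)) *
          hyp3F2Term a (b + 1) (c + 1) (a + (b + 1)) (1 + (c + 1)) 1 n -
        hyp3F2Term a b c (a + b) (1 + c) 1 n =
      gaussTerm a b (a + b) n * (n / (c + n)) * (n + (b + c)) / b -
        gaussTerm a b (a + b) (n + 1) * ((n + 1 : ℕ) / (c + (n + 1 : ℕ))) *
          ((n + 1 : ℕ) + (b + c)) / b := by
  have hc0 : 1 + c ≠ 0 := by simpa using hc 0
  have hab0 : a + b ≠ 0 := by simpa using hab 0
  have hc1 : ∀ m : ℕ, 1 + (c + 1) ≠ -m := by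
    simpa only [add_assoc] using add_one_ne_neg_natCast hc
  have hu := natCast_div_add_mul_cancel hc n
  have hcn := add_natCast_ne_zero hc n
  have habn := add_natCast_ne_zero hab n
  have hn : (n : ℂ) + 1 ≠ 0 := n.cast_add_one_ne_zero
  have hshift : gaussTerm a (b + 1) (a + (b + 1)) n =
      (a + b) * (b + n) * gaussTerm a b (a + b) n / (b * (a + b + n)) := by
    rw [eq_div_iff (mul_ne_zero hb habn), ← add_assoc]
    linear_combination gaussTerm_add_one_add_one a b hab n
  have hsucc : gaussTerm a b (a + b) (n + 1) =
      (a + n) * (b + n) * gaussTerm a b (a + b) n / ((n + 1) * (a + b + n)) := by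
    rw [eq_div_iff (mul_ne_zero hn habn)]
    linear_combination gaussTerm_succ a b hab n
  rw [hyp3F2Term_add_one_eq_gaussTerm_mul a b _ hc,
    hyp3F2Term_add_one_eq_gaussTerm_mul a (b + 1) _ hc1, hshift, hsucc]
  generalize (n : ℂ) / (c + n) = u at hu ⊢
  push_cast
  rw [show c + 1 + n = 1 + c + n by ring, show c + (n + 1 : ℂ) = 1 + c + n by ring]
  field_simp
  linear_combination -gaussTerm a b (a + b) n * (1 + c) * (1 + c + n) * (a + b + n) * hu

theorem balanced3F2_eq_add_one_add_one {c : ℂ} (hb : b ≠ 0) (hc : ∀ m : ℕ, 1 + c ≠ -m) :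
    balanced3F2 a b c = (1 + c - a) / (1 + c) * (b / (a + b) * balanced3F2 a (b + 1) (c + 1)) +
      invBeta a b / b := by
  have hc1 : ∀ m : ℕ, 1 + (c + 1) ≠ -m := by
    simpa only [add_assoc] using add_one_ne_neg_natCast hc
  have hab1 : ∀ m : ℕ, a + (b + 1) ≠ -m := by
    simpa only [add_assoc] using add_one_ne_neg_natCast hab
  have hsum := summable_balanced hab hc
  have hsum' := (summable_balanced hab1 hc1).mul_left ((1 + c - a) / (1 + c) * (b / (a + b)))
  have htel := tsum_eq_of_forall_eq_sub (hsum'.sub hsum)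
    (v := fun n : ℕ => gaussTerm a b (a + b) n * (n / (c + n)) * (n + (b + c)) / b)
    (hyp3F2Term_add_one_add_one_sub hab hb hc)
    ((tendsto_gaussTerm_mul_div hab c (b + c)).div_const b)
  rw [hsum'.tsum_sub hsum, tsum_mul_left] at htel
  simp only [Nat.cast_zero, zero_div, mul_zero, zero_mul, zero_sub] at htel
  rw [balanced3F2, balanced3F2, hyp3F2, hyp3F2]
  linear_combination -htel

end

theorem hyp3F2Term_add_one_sub_hyp3F2Term_add_one (a b d : ℂ) {c c' : ℂ} (hc : ∀ m : ℕ, c ≠ -m)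
    (hc' : ∀ m : ℕ, c' ≠ -m) (n : ℕ) :
    hyp3F2Term a b c d (1 + c) 1 n - hyp3F2Term a b c' d (1 + c') 1 n =
      n * gaussTerm a b d n * ((c - c') / ((c + n) * (c' + n))) := by
  have hcn := add_natCast_ne_zero hc n
  have hcn' := add_natCast_ne_zero hc' n
  rw [hyp3F2Term_add_one_eq_gaussTerm_mul a b d (one_add_ne_neg_natCast hc),
    hyp3F2Term_add_one_eq_gaussTerm_mul a b d (one_add_ne_neg_natCast hc')]
  field_simp
  ring

theorem tendsto_inv_add_natCast (z : ℂ) : Tendsto (fun N : ℕ => (z + N)⁻¹) atTop (𝓝 0) :=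
  tendsto_inv₀_cobounded.comp
    ((tendsto_const_add_cobounded z).comp tendsto_natCast_atTop_cobounded)

theorem norm_mul_div_add_natCast_mul_le {x r z z' : ℂ} {M : ℝ} (hz : 0 < z.re) (hz' : 0 < z'.re)
    (N : ℕ) {n : ℕ} (hx : ‖n * x‖ ≤ M) :
    ‖n * x * (r / ((z + n + N) * (z' + n + N)))‖ ≤ M * (‖r‖ * ((n : ℝ) ^ 2)⁻¹) := by
  rcases eq_or_ne n 0 with rfl | hn
  · simp
  have hM : 0 ≤ M := (norm_nonneg _).trans hx
  have : (0 : ℝ) < n := Nat.cast_pos.2 hn.bot_lt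
  have hle {y : ℂ} (hy : 0 < y.re) : (n : ℝ) ≤ ‖y + n + N‖ := by
    rw [add_right_comm]
    exact natCast_le_norm_add_natCast (by simp only [add_re, natCast_re]; positivity) n
  rw [norm_mul, norm_div, norm_mul (z + n + N), div_eq_mul_inv, sq]
  gcongr
  exacts [hle hz, hle hz']

theorem tendsto_balanced3F2_sub_balanced3F2 {a b c c' : ℂ} (hab : ∀ m : ℕ, a + b ≠ -m)
    (hc : 0 < c.re) (hc' : 0 < c'.re) :
    Tendsto (fun N : ℕ => balanced3F2 a b (c + N) - balanced3F2 a b (c' + N)) atTop (𝓝 0) := by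
  have hne {z : ℂ} (hz : 0 < z.re) (N m : ℕ) : z + N ≠ -m :=
    add_natCast_ne_neg_natCast (ne_neg_natCast_of_re_pos hz) N m
  have hsum {z : ℂ} (hz : 0 < z.re) (N : ℕ) :=
    summable_balanced hab (one_add_ne_neg_natCast (hne hz N))
  obtain ⟨M, hM⟩ := (tendsto_natCast_mul_gaussTerm_add hab).norm.bddAbove_range
  have hterm (n : ℕ) : Tendsto (fun N : ℕ => n * gaussTerm a b (a + b) n *
      ((c - c') / ((c + n + N) * (c' + n + N)))) atTop (𝓝 0) := by
    simpa only [mul_inv, div_eq_mul_inv, mul_zero] using (((tendsto_inv_add_natCast (c + n)).mul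
      (tendsto_inv_add_natCast (c' + n))).const_mul (c - c')).const_mul
        (n * gaussTerm a b (a + b) n)
  have hlim := tendsto_tsum_of_dominated_convergence
    (((Real.summable_nat_pow_inv.2 one_lt_two).mul_left ‖c - c'‖).mul_left M) hterm
    (.of_forall fun N n => norm_mul_div_add_natCast_mul_le hc hc' N (hM ⟨n, rfl⟩))
  rw [tsum_zero] at hlim
  refine hlim.congr fun N => ?_
  rw [balanced3F2, balanced3F2, hyp3F2, hyp3F2, ← (hsum hc N).tsum_sub (hsum hc' N)]
  refine tsum_congr fun n => ?_
  rw [hyp3F2Term_add_one_sub_hyp3F2Term_add_one a b _ (hne hc N) (hne hc' N), add_right_comm c,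
    add_right_comm c', add_sub_add_right_eq_sub]

/-- The difference of the two sides of the formula. -/
noncomputable def defect (a b c : ℂ) : ℂ :=
  balanced3F2 a b c - gammaFactor a b c * digammaBracket a b c

theorem defect_add_one {a b c : ℂ} (hab : ∀ m : ℕ, a + b ≠ -m) (hc : ∀ m : ℕ, 1 + c ≠ -m)
    (hcb : ∀ m : ℕ, 1 + c - b ≠ -m) (hcab : ∀ m : ℕ, 1 + c - a - b ≠ -m)
    (hca : 0 < (1 + c - a).re) :
    (1 + c) * (1 + c - a - b) * defect a b c =
      (1 + c - a) * (1 + c - b) * defect a b (c + 1) := by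
  rw [defect, defect]
  linear_combination balanced3F2_add_one_right hab hc - closedForm_add_one hc hcb hcab hca

theorem defect_add_one_eq_zero {a b c : ℂ} (hab : ∀ m : ℕ, a + b ≠ -m) (hc : ∀ m : ℕ, 1 + c ≠ -m)
    (hcb : ∀ m : ℕ, 1 + c - b ≠ -m) (hcab : ∀ m : ℕ, 1 + c - a - b ≠ -m)
    (hca : 0 < (1 + c - a).re) (h : defect a b c = 0) : defect a b (c + 1) = 0 := by
  have hrec := defect_add_one hab hc hcb hcab hca
  rw [h, mul_zero, eq_comm] at hrec
  exact (mul_eq_zero.1 hrec).resolve_left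
    (mul_ne_zero (by simpa using ne_neg_natCast_of_re_pos hca 0) (by simpa using hcb 0))

theorem digammaBracket_add_sub_one {a b : ℂ} (ha : ∀ m : ℕ, a ≠ -m) (hb : 0 < b.re) :
    digammaBracket a b (a + b - 1) = 0 := by
  have hone : ∀ m : ℕ, (1 : ℂ) ≠ -m := ne_neg_natCast_of_re_pos (by simp)
  have hterm (n : ℕ) : gaussTerm a (1 - b) a (n + 1) = gaussTerm (1 - b) 1 1 (n + 1) := by
    rw [gaussTerm, gaussTerm, mul_comm, mul_div_mul_right _ _ (poch_ne_zero ha _),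
      mul_div_mul_right _ _ (poch_ne_zero hone _)]
  simp only [digammaBracket, keyTerm_succ, show 1 + (a + b - 1) - b = a by ring, hterm]
  rw [tsum_gaussTerm_one_div (1 - b) hone (by simpa using hb), sub_sub_cancel, digamma_one]
  ring

theorem digammaBracket_add {a b : ℂ} (ha : ∀ m : ℕ, a ≠ -m) (hb : 0 < b.re) :
    digammaBracket a b (a + b) = Gamma a * Gamma b / Gamma (a + b) := by
  have h := digammaBracket_add_one_sub (a := a) (b := b) (c := a + b - 1)
    (by rwa [show 1 + (a + b - 1) - b = a by ring])
    (by rwa [show 1 + (a + b - 1) - a = b by ring])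
  rw [digammaBracket_add_sub_one ha hb, sub_zero, sub_add_cancel] at h
  rw [h, show 1 + (a + b - 1) - b = a by ring, show 1 + (a + b - 1) - a = b by ring,
    show 2 + (a + b - 1) - a - b = 1 by ring, show 1 + (a + b - 1) = a + b by ring, Gamma_one,
    one_mul]

theorem balanced3F2_add {a b : ℂ} (hab : ∀ m : ℕ, a + b ≠ -m) :
    balanced3F2 a b (a + b) = ₂F₁ a b (1 + (a + b)) (1 : ℂ) := by
  rw [balanced3F2, hyp3F2, ordinaryHypergeometric_one_eq_tsum]
  refine tsum_congr fun n => ?_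
  rw [hyp3F2Term, gaussTerm, one_pow, mul_one, mul_right_comm _ (poch (a + b) n),
    mul_div_mul_right _ _ (poch_ne_zero hab n)]

theorem defect_add {a b : ℂ} (ha : ∀ m : ℕ, a ≠ -m) (hb : 0 < b.re) (hab : ∀ m : ℕ, a + b ≠ -m) :
    defect a b (a + b) = 0 := by
  have hΓa := Gamma_ne_zero ha
  have hΓb := Gamma_ne_zero (ne_neg_natCast_of_re_pos hb)
  have hΓab := Gamma_ne_zero hab
  rw [defect, balanced3F2_add hab, gammaFactor_eq_invBeta_mul (one_add_ne_neg_natCast hab)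
    (by rw [show 1 + (a + b) - a - b = 1 by ring]; simp),
    digammaBracket_add ha hb, invBeta]
  field_simp
  ring

theorem defect_add_add_natCast {a b : ℂ} (ha : ∀ m : ℕ, a ≠ -m) (hb : 0 < b.re)
    (hab : ∀ m : ℕ, a + b ≠ -m) (N : ℕ) : defect a b (a + b + N) = 0 := by
  induction N with
  | zero => simpa using defect_add ha hb hab
  | succ N ih =>
    have hc : 1 + (a + b + N) = a + b + (N + 1 : ℕ) := by push_cast; ring
    have hcb : 1 + (a + b + N) - b = a + (N + 1 : ℕ) := by push_cast; ring
    rw [show a + b + (N + 1 : ℕ) = a + b + N + 1 by push_cast; ring]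
    refine defect_add_one_eq_zero hab ?_ ?_ (ne_neg_natCast_of_re_pos ?_) ?_ ih
    · rw [hc]
      exact add_natCast_ne_neg_natCast hab (N + 1)
    · rw [hcb]
      exact add_natCast_ne_neg_natCast ha (N + 1)
    all_goals simp; linarith [N.cast_nonneg (α := ℝ)]

theorem isBigO_add_natCast_sub_div_sub_one (a : ℂ) {z : ℂ} (hz : 0 < z.re) :
    (fun N : ℕ => (z + N - a) / (z + N) - 1) =O[atTop] fun N : ℕ => (N : ℝ)⁻¹ := by
  refine IsBigO.of_bound ‖a‖ ?_
  filter_upwards [eventually_gt_atTop 0] with N hN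
  have : (0 : ℝ) < N := Nat.cast_pos.2 hN
  rw [div_sub_one (add_natCast_ne_zero (ne_neg_natCast_of_re_pos hz) N), sub_sub_cancel_left,
    norm_div, norm_neg, norm_inv, Real.norm_natCast, div_eq_mul_inv]
  gcongr
  exact natCast_le_norm_add_natCast hz N

/-- The assertion that `₃F₂(a, b, c + N; a + b, 1 + c + N; 1) = logAsymptote a b N + o(1)` as
`N → ∞`, whenever `0 < Re c`. -/
def HasLogAsymptotics (a b : ℂ) : Prop :=
  ∀ c : ℂ, 0 < c.re →
    Tendsto (fun N : ℕ => balanced3F2 a b (c + N) - logAsymptote a b N) atTop (𝓝 0)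

namespace HasLogAsymptotics

theorem symm {a b : ℂ} (h : HasLogAsymptotics a b) : HasLogAsymptotics b a := fun c hc =>
  (h c hc).congr fun N => by rw [balanced3F2_comm, logAsymptote_comm]

theorem of_re_pos {a b : ℂ} (ha : 0 < a.re) (hb : 0 < b.re) : HasLogAsymptotics a b := by
  intro c hc
  have hab : 0 < (a + b).re := by simpa using add_pos ha hb
  have hab' := ne_neg_natCast_of_re_pos hab
  have hbase := tendsto_closedForm_sub_logAsymptote (a := a) (b := b) (c := a + b)
    (by simp; linarith) (by simp; linarith) (by simp; linarith) (by simp; linarith)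
  have h := (tendsto_balanced3F2_sub_balanced3F2 hab' hc hab).add hbase
  rw [add_zero] at h
  refine h.congr fun N => ?_
  rw [← sub_eq_zero.1 (defect_add_add_natCast (ne_neg_natCast_of_re_pos ha) hb hab' N)]
  ring

theorem of_add_one_right {a b : ℂ} (hb : ∀ m : ℕ, b ≠ -m) (hab : ∀ m : ℕ, a + b ≠ -m)
    (h : HasLogAsymptotics a (b + 1)) : HasLogAsymptotics a b := by
  intro c hc
  have hb0 : b ≠ 0 := by simpa using hb 0
  have hab0 : a + b ≠ 0 := by simpa using hab 0
  have hc1 : 0 < (1 + c).re := by simp only [add_re, one_re]; positivity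
  have hq := isBigO_add_natCast_sub_div_sub_one a hc1
  have hf : Tendsto (fun N : ℕ => b / (a + b) * balanced3F2 a (b + 1) (1 + c + N) +
      invBeta a b / b - logAsymptote a b N) atTop (𝓝 0) := by
    have hlim := (h (1 + c) hc1).const_mul (b / (a + b))
    rw [mul_zero] at hlim
    refine hlim.congr fun N => ?_
    rw [← logAsymptote_add_one_right a hb hab0 N]
    ring
  have hlim := (tendsto_mul_sub_logAsymptote a b hq hf).sub
    ((hq.trans_tendsto tendsto_inv_atTop_nhds_zero_nat).mul_const (invBeta a b / b))
  rw [zero_mul, sub_zero] at hlim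
  refine hlim.congr fun N => ?_
  have hcN := add_natCast_ne_neg_natCast (ne_neg_natCast_of_re_pos hc) N
  rw [balanced3F2_eq_add_one_add_one hab hb0 (one_add_ne_neg_natCast hcN), ← add_assoc,
    show c + N + 1 = 1 + c + N by ring]
  ring

theorem of_add_natCast_right {a b : ℂ} (hb : ∀ m : ℕ, b ≠ -m) (hab : ∀ m : ℕ, a + b ≠ -m) (k : ℕ)
    (h : HasLogAsymptotics a (b + k)) : HasLogAsymptotics a b := by
  induction k with
  | zero => simpa using h
  | succ k ih =>
    refine ih (of_add_one_right (add_natCast_ne_neg_natCast hb k) ?_ ?_)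
    · simpa only [add_assoc] using add_natCast_ne_neg_natCast hab k
    · simpa only [Nat.cast_succ, add_assoc] using h

end HasLogAsymptotics

theorem hasLogAsymptotics {a b : ℂ} (ha : ∀ m : ℕ, a ≠ -m) (hb : ∀ m : ℕ, b ≠ -m)
    (hab : ∀ m : ℕ, a + b ≠ -m) : HasLogAsymptotics a b := by
  obtain ⟨k, hk⟩ := exists_nat_gt (-a.re)
  obtain ⟨l, hl⟩ := exists_nat_gt (-b.re)
  have hkl : HasLogAsymptotics (a + k) (b + l) :=
    .of_re_pos (by simp; linarith) (by simp; linarith)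
  have hk' : HasLogAsymptotics (a + k) b := hkl.of_add_natCast_right hb
    (by simpa only [add_right_comm] using add_natCast_ne_neg_natCast hab k)
  exact (hk'.symm.of_add_natCast_right ha (by rwa [add_comm])).symm

theorem tendsto_defect_add_natCast {a b : ℂ} (ha : ∀ m : ℕ, a ≠ -m) (hb : ∀ m : ℕ, b ≠ -m)
    (hab : ∀ m : ℕ, a + b ≠ -m) (c : ℂ) :
    Tendsto (fun N : ℕ => defect a b (c + N)) atTop (𝓝 0) := by
  obtain ⟨k, hk⟩ := exists_nat_gt (|a.re| + |b.re| + |c.re|)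
  have hre : 0 < c.re + k - |a.re| - |b.re| := by linarith [neg_abs_le c.re]
  have ha' := abs_le.1 (le_refl |a.re|)
  have hb' := abs_le.1 (le_refl |b.re|)
  have h := (hasLogAsymptotics ha hb hab (c + k) (by simp; linarith)).sub
    (tendsto_closedForm_sub_logAsymptote (a := a) (b := b) (c := c + k)
      (by simp; linarith) (by simp; linarith) (by simp; linarith) (by simp; linarith))
  rw [sub_zero] at h
  rw [← tendsto_add_atTop_iff_nat k]
  refine h.congr fun N => ?_
  rw [defect, sub_sub_sub_cancel_right, show c + k + N = c + (N + k : ℕ) by push_cast; ring]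

theorem defect_eq_zero {a b c : ℂ} (ha : ∀ m : ℕ, a ≠ -m) (hb : ∀ m : ℕ, b ≠ -m)
    (hab : ∀ m : ℕ, a + b ≠ -m) (hc : ∀ m : ℕ, 1 + c ≠ -m) (hcb : ∀ m : ℕ, 1 + c - b ≠ -m)
    (hcab : ∀ m : ℕ, 1 + c - a - b ≠ -m) (hca : 0 < (1 + c - a).re) : defect a b c = 0 := by
  have hrec (n : ℕ) : (1 + c + n) * (1 + c - a - b + n) * defect a b (c + n) =
      (1 + c - a + n) * (1 + c - b + n) * defect a b (c + (n + 1 : ℕ)) := by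
    have hcn : 1 + (c + n) = 1 + c + n := (add_assoc 1 c n).symm
    have hcan : 1 + c + n - a = 1 + c - a + n := add_sub_right_comm _ _ _
    have hcbn : 1 + c + n - b = 1 + c - b + n := add_sub_right_comm _ _ _
    have hcabn : 1 + c - a + n - b = 1 + c - a - b + n := add_sub_right_comm _ _ _
    have h := defect_add_one (c := c + n) hab
      (by rw [hcn]; exact add_natCast_ne_neg_natCast hc n)
      (by rw [hcn, hcbn]; exact add_natCast_ne_neg_natCast hcb n)
      (by rw [hcn, hcan, hcabn]; exact add_natCast_ne_neg_natCast hcab n)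
      (by rw [hcn, hcan]; simp only [add_re, natCast_re]; positivity)
    rwa [hcn, hcan, hcbn, hcabn, add_assoc c, ← Nat.cast_succ] at h
  have h := eq_Gamma_mul_of_recurrence (f := fun n : ℕ => defect a b (c + n)) (by ring) hc hcab hrec
    (tendsto_defect_add_natCast ha hb hab c)
  simpa using h

theorem mainTheorem4_general {a b c : ℂ} (ha : ∀ m : ℕ, a ≠ -m) (hb : ∀ m : ℕ, b ≠ -m)
    (hab : ∀ m : ℕ, a + b ≠ -m) (hc : ∀ m : ℕ, 1 + c ≠ -m) (hcb : ∀ m : ℕ, 1 + c - b ≠ -m)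
    (hcab : ∀ m : ℕ, 1 + c - a - b ≠ -m) (hca : 0 < (1 + c - a).re) :
    Summable (fun n : ℕ => hyp3F2Term a b c (a + b) (1 + c) 1 n) ∧
      Summable (fun n : ℕ => keyTerm a b c (n + 1)) ∧
      hyp3F2 a b c (a + b) (1 + c) 1 =
        gammaFactor a b c * (digamma (1 + c - b) - digamma a - digamma b
            - (Real.eulerMascheroniConstant : ℂ))
          - gammaFactor a b c * ∑' n : ℕ, keyTerm a b c (n + 1) := by
  refine ⟨summable_balanced hab hc, summable_keyTerm hcb hca, ?_⟩
  rw [← mul_sub]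
  exact sub_eq_zero.1 (defect_eq_zero ha hb hab hc hcb hcab hca)

theorem ne_neg_natCast_of_neg_one_lt_re {z : ℂ} (h : -1 < z.re) (hz : z ≠ 0) (m : ℕ) : z ≠ -m := by
  rcases m with _ | m
  · simpa using hz
  · rintro rfl
    simp at h
    linarith [m.cast_nonneg (α := ℝ)]

theorem mainTheorem4 :
    ∃ δ : ℝ, 0 < δ ∧ ∀ a b c : ℂ,
      |a.re| < δ → |b.re| < δ → |c.re| < δ →
      a ≠ 0 → b ≠ 0 → a + b ≠ 0 →
      Summable (fun n : ℕ => hyp3F2Term a b c (a + b) (1 + c) 1 n) ∧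
      Summable (fun n : ℕ => keyTerm a b c (n + 1)) ∧
      hyp3F2 a b c (a + b) (1 + c) 1 =
        gammaFactor a b c *
            (Complex.digamma (1 + c - b) - Complex.digamma a - Complex.digamma b
              - (Real.eulerMascheroniConstant : ℂ))
          - gammaFactor a b c * ∑' n : ℕ, keyTerm a b c (n + 1) := by
  refine ⟨1 / 3, by norm_num, fun a b c hare hbre hcre ha hb hab => ?_⟩
  rw [abs_lt] at hare hbre hcre
  exact mainTheorem4_general
    (ne_neg_natCast_of_neg_one_lt_re (by linarith) ha)
    (ne_neg_natCast_of_neg_one_lt_re (by linarith) hb)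
    (ne_neg_natCast_of_neg_one_lt_re (by rw [add_re]; linarith) hab)
    (ne_neg_natCast_of_re_pos (by simp; linarith))
    (ne_neg_natCast_of_re_pos (by simp; linarith))
    (ne_neg_natCast_of_re_pos (by simp; linarith))
    (by simp; linarith)
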